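/- \textbf{Setting.} Let $f:\mathcal G^2\to\mathcal G^2$ be a $\beta$-train track map, relative to $X\subset\mathcal G^2$, representing an automorphism of a free group of finite rank. Thus $\mathcal G^2$ is a finite connected 2-complex. Its 1-skeleton is $\mathcal G^1=X\cup\widehat\Gamma$, where $X$ (the relative part) is a graph containing all vertices and $\widehat\Gamma$ (the train track part) is a finite set of edges with endpoints in $X$. The map $f$ maps vertices to vertices, edges to edge paths and $X$ to $X$, and induces an isomorphism on $\pi_1(\mathcal G^2)$. A subgraph $\Gamma\supset\widehat\Gamma$ of $\mathcal G^1$ is given; $X$ consists of the edges of $\Gamma\smallsetminus\widehat\Gamma$ and of finitely many \emph{auxiliary edges} $e$ with endpoints at vertices of $\Gamma$. Technically an auxiliary edge is the union of two half-edges meeting at an auxiliary vertex. Several auxiliary edges may share their auxiliary vertex and then form a star of half-edges, any two distinct half-edges of which form one auxiliary edge; auxiliary vertices are not admitted as endpoints of paths. All paths in $\mathcal G^1$ are edge paths whose first and/or last edge may be only partially traversed (and then belongs to $\widehat\Gamma$), and their subpaths in $X$ are considered up to homotopy in $X$ rel endpoints. A path is \emph{relatively reduced} if each of its subpaths that is homotopic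 in $\mathcal G^2$ rel endpoints to a path in $X$ is contained in $X$. It is \emph{legal} if its image under $f^t$ is relatively reduced for all $t\ge 1$. A \emph{turn} is a path $e\circ\chi\circ e'$ with $e,e'\in\widehat\Gamma$ and $\chi$ a (possibly trivial) reduced path in $X$. An \emph{INP} is a reduced path $\eta$ in $\mathcal G^1$ with first and last edge in $\widehat\Gamma$ which is a concatenation of two legal paths, such that $f^t(\eta)$ is not legal for any $t\ge 0$, and $f^{t_0}(\eta)$ is homotopic to $\eta$ rel endpoints in $\mathcal G^1$ for some $t_0\ge 1$. Every auxiliary edge $e$ is associated with an INP $\widehat r(e)$ with the same endpoints, every INP is associated with an auxiliary edge, and the 2-cells of $\mathcal G^2$ are the Nielsen faces, one for every auxiliary edge $e$, with boundary $\bar e\circ\widehat r(e)$. Replacing repeatedly all auxiliary edges $e$ by $\widehat r(e)$ ends after finitely many steps and gives a retraction $r$ of $\mathcal G^2$ onto $\Gamma$; the paths $r(e)$, which are reduced paths in $\Gamma$, are called \emph{pre-INPs}. A legal path is \emph{strongly legal} if, after replacing every auxiliary edge $e$ on it by $\widehat r(e)$, its only non-legal turns are the non-legal turns (tips) of these INPs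 $\widehat r(e)$. A turn $e\circ\chi\circ e'$ is \emph{illegal} if it is not legal or if $e\circ\chi$ or $\chi\circ e'$ is not strongly legal. Moreover $f$ satisfies the defining properties of a $\beta$-train track map: \begin{itemize} \item the components of $X$ are $\pi_1$-injective in $\mathcal G^2$, and loops in $X$ have polynomial growth under $f$; \item $r\circ f|_\Gamma$ is (up to tightening the images of edges) a relative train track map in the sense of Bestvina--Handel; \item every edge $e$ of $\widehat\Gamma$ is strongly legal (hence legal), and some $f^t(e)$, $t\ge1$, runs over at least two edges of $\widehat\Gamma$; \item $f$ maps strongly legal paths to strongly legal paths; \item the following lift to quasi-geodesics in the universal covering of $\mathcal G^2$, with uniform constants: strongly legal paths, reduced paths in $\Gamma$, paths mapped by $r$ to reduced paths, and paths obtained from strongly legal ones by applying $r$ to some subpaths; \item every path (loop) in $\mathcal G^1$ has an $f$-iterate which is homotopic rel endpoints (freely homotopic) in $\mathcal G^2$ to a legal path (loop), and every path has an iterate which is homotopic rel endpoints in $\mathcal G^2$ to a strongly legal path, with an exponent that depends only on the number of illegal turns of the path. \end{itemize} \textbf{Definition.} A pre-INP $r(e)$ occurring as a subpath of a reduced path $\rho$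 in $\Gamma$ is \emph{isolated} if any other pre-INP occurring in $\rho$ that intersects it in more than a point is contained in it as a subpath. A path $\gamma$ in $\mathcal G^1$ is \emph{normalized} if (i) the path $r(\gamma)$ in $\Gamma$ is reduced, and (ii) $\gamma$ is obtained from $r(\gamma)$ through replacing every isolated pre-INP $r(e)$ of $r(\gamma)$ by the associated auxiliary edge $e$. \textbf{Proposition.} For every path $\gamma$ in $\mathcal G^1$ there is a unique normalized path $\gamma_*$ in $\mathcal G^1$ which is homotopic to $\gamma$ in $\mathcal G^2$ relative to its endpoints. -/

import Mathlib

/-!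
Combinatorial model of the 2-complex of a beta-train track map.

The 1-skeleton is a finite graph.  It consists of a graph `Γ` (vertex type `V`, edge type `E`, each
edge with a preferred orientation and parametrised by the unit interval) and of auxiliary
half-edges (type `H`).  An auxiliary half-edge joins its foot, a vertex of `Γ`, to its centre, an
auxiliary vertex (type `C`).  An (oriented) auxiliary edge is an ordered pair of distinct
half-edges with the same centre; auxiliary edges that share their auxiliary vertex form a star
(a tripod, if there are three half-edges).
-/

namespace BetaTT

universe u₁ u₂ u₃ u₄

/-- The 1-skeleton: the graph `Γ`, its train track edges `hat`, and the auxiliary half-edges. -/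
structure Skeleton (V : Type u₁) (E : Type u₂) (H : Type u₃) (C : Type u₄) where
  /-- initial vertex of an edge of `Γ` (for the preferred orientation) -/
  src : E → V
  /-- terminal vertex of an edge of `Γ` (for the preferred orientation) -/
  tgt : E → V
  /-- the edges of the train track part -/
  hat : Set E
  /-- the vertex of `Γ` at which an auxiliary half-edge is attached -/
  foot : H → V
  /-- the auxiliary vertex of an auxiliary half-edge -/
  ctr : H → C

variable {V : Type u₁} {E : Type u₂} {H : Type u₃} {C : Type u₄}

/-- Oriented auxiliary edges: run through the half-edge `i` from its foot to its centre, and then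
through the half-edge `t` from the centre to its foot. -/
@[ext]
structure Skeleton.Aux (G : Skeleton V E H C) where
  i : H
  t : H
  ne : i ≠ t
  ctr_eq : G.ctr i = G.ctr t

/-- The auxiliary edge with inverted orientation. -/
def Skeleton.Aux.inv {G : Skeleton V E H C} (x : G.Aux) : G.Aux :=
  ⟨x.t, x.i, x.ne.symm, x.ctr_eq.symm⟩

/-- The letters of which paths are composed: a (monotone) segment of an edge `e` of `Γ`, from the
point with parameter `a` to the point with parameter `b`, or a whole oriented auxiliary edge. -/
inductive Skeleton.Letter (G : Skeleton V E H C) : Type (max u₂ u₃)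
  | seg (e : E) (a b : unitInterval) : G.Letter
  | aux (x : G.Aux) : G.Letter

/-- Points of `Γ`: vertices, and interior points of edges. -/
inductive Skeleton.Pt (_G : Skeleton V E H C) : Type (max u₁ u₂)
  | vert (v : V) : Skeleton.Pt _G
  | inner (e : E) (a : unitInterval) (h0 : a ≠ 0) (h1 : a ≠ 1) : Skeleton.Pt _G

namespace Skeleton

variable (G : Skeleton V E H C)

open Classical in
/-- The point with parameter `a` on the edge `e`. -/
noncomputable def point (e : E) (a : unitInterval) : G.Pt :=
  if h0 : a = 0 then .vert (G.src e) else if h1 : a = 1 then .vert (G.tgt e) else .inner e a h0 h1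

variable {G}

noncomputable def Letter.start : G.Letter → G.Pt
  | .seg e a _ => G.point e a
  | .aux x => .vert (G.foot x.i)

noncomputable def Letter.finish : G.Letter → G.Pt
  | .seg e _ b => G.point e b
  | .aux x => .vert (G.foot x.t)

/-- Inversion of the orientation of a letter. -/
def Letter.inv : G.Letter → G.Letter
  | .seg e a b => .seg e b a
  | .aux x => .aux x.inv

/-- The letter is an edge that is entirely traversed. -/
def Letter.Full : G.Letter → Prop
  | .seg _ a b => (a = 0 ∧ b = 1) ∨ (a = 1 ∧ b = 0)
  | .aux _ => True

/-- The letter belongs to the train track part. -/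
def Letter.InHat : G.Letter → Prop
  | .seg e _ _ => e ∈ G.hat
  | .aux _ => False

/-- The letter belongs to the relative part `X`, which consists of the auxiliary edges and of the
edges of `Γ` outside of the train track part. -/
def Letter.InX : G.Letter → Prop
  | .seg e _ _ => e ∉ G.hat
  | .aux _ => True

/-- The letter belongs to `Γ`. -/
def Letter.InΓ : G.Letter → Prop
  | .seg _ _ _ => True
  | .aux _ => False

/-- The word `w` with inverted orientation. -/
def invW (w : List G.Letter) : List G.Letter := (w.map Letter.inv).reverse

/-- `IsPath p w q`: the letters of `w` fit together to a path from `p` to `q`. -/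
def IsPath : G.Pt → List G.Letter → G.Pt → Prop
  | p, [], q => p = q
  | p, x :: w, q => x.start = p ∧ IsPath x.finish w q

/-- Classical edge paths. -/
def IsEdgePath (p : V) (w : List G.Letter) (q : V) : Prop :=
  IsPath (.vert p : G.Pt) w (.vert q) ∧ ∀ x ∈ w, x.Full

/-- The paths that are considered in the 1-skeleton: edge paths, immersed except possibly at
vertices, with possibly only partially traversed first and/or last edge (or contained in a single
edge).  A partially traversed edge has to belong to the train track part. -/
def IsGPath (p : G.Pt) (w : List G.Letter) (q : G.Pt) : Prop :=
  IsPath p w q ∧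
  (∀ e a b, Letter.seg e a b ∈ w →
    a ≠ b ∧ (e ∈ G.hat ∨ (Letter.seg e a b : G.Letter).Full)) ∧
  w.IsChain (fun x _ => ∃ v, x.finish = .vert v)

/-- For two consecutive letters of a path (which meet at a vertex of `Γ`): the second one starts by
running back along the first one. -/
def Backtrack : G.Letter → G.Letter → Prop
  | .seg e _ b, .seg e' b' _ => e = e' ∧ b = b'
  | .aux x, .aux y => x.t = y.i
  | _, _ => False

/-- Reduced paths in the graph. -/
def Reduced (w : List G.Letter) : Prop := w.IsChain (fun x y => ¬ Backtrack x y)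

/-- The subpaths contained in the relative part are reduced paths in the graph `X`. -/
def XReduced (w : List G.Letter) : Prop :=
  w.IsChain (fun x y => x.InX → y.InX → ¬ Backtrack x y)

/-- Elementary homotopies in the graph. -/
inductive GraphMove : List G.Letter → List G.Letter → Prop
  | merge (e : E) (a b c : unitInterval) : GraphMove [.seg e a b, .seg e b c] [.seg e a c]
  | const (e : E) (a : unitInterval) : GraphMove [.seg e a a] []
  | cancel (x : G.Aux) : GraphMove [.aux x, .aux x.inv] []
  | star (x y z : G.Aux) (hxy : x.t = y.i) (hi : z.i = x.i) (ht : z.t = y.t) :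
      GraphMove [.aux x, .aux y] [.aux z]

/-- Homotopy relative endpoints `p`, `q`, generated by the elementary homotopies in `R`. -/
def Homotopic (R : List G.Letter → List G.Letter → Prop) (p q : G.Pt) (w w' : List G.Letter) :
    Prop :=
  IsPath p w q ∧ IsPath p w' q ∧
  Relation.EqvGen (fun c d => IsPath p c q ∧ IsPath p d q ∧
    ∃ u v l l', R l l' ∧ c = u ++ l ++ v ∧ d = u ++ l' ++ v) w w'

/-- Homotopy in the 1-skeleton. -/
def HomG1 (p q : G.Pt) (w w' : List G.Letter) : Prop := Homotopic GraphMove p q w w'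

/-- Homotopy in the relative part (applied to subpaths contained in the relative part). -/
def HomX (p q : G.Pt) (w w' : List G.Letter) : Prop :=
  Homotopic (fun l l' => GraphMove l l' ∧ (∀ x ∈ l, x.InX) ∧ ∀ x ∈ l', x.InX) p q w w'

/-- Homotopy in `Γ`. -/
def HomΓ (p q : G.Pt) (w w' : List G.Letter) : Prop :=
  Homotopic (fun l l' => GraphMove l l' ∧ (∀ x ∈ l, x.InΓ) ∧ ∀ x ∈ l', x.InΓ) p q w w'

open Classical in
/-- The image of a whole oriented edge under a map that is given by the images `φ` of the edges of
`Γ` (with preferred orientation) and `ψ` of the oriented auxiliary edges.  Only applied to whole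
edges. -/
noncomputable def mapLetter (φ : E → List G.Letter) (ψ : G.Aux → List G.Letter) :
    G.Letter → List G.Letter
  | .seg e a b =>
      if a = 0 ∧ b = 1 then φ e else if a = 1 ∧ b = 0 then invW (φ e) else []
  | .aux x => ψ x

/-- The image of an edge path. -/
noncomputable def mapWord (φ : E → List G.Letter) (ψ : G.Aux → List G.Letter)
    (w : List G.Letter) : List G.Letter := w.flatMap (mapLetter φ ψ)

/-! ### Relative train track maps (in the sense of Bestvina and Handel) on `Γ` -/

open Classical in
/-- The number of times that `w` crosses the edge `e` of `Γ`, in either direction. -/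
noncomputable def crossings (w : List G.Letter) (e : E) : ℕ :=
  (w.filter (fun x => decide (∃ a b, x = Letter.seg e a b))).length

/-- The letter lies on an edge of `Γ` that satisfies `P`. -/
def Letter.On (P : E → Prop) : G.Letter → Prop
  | .seg e _ _ => P e
  | .aux _ => False

section RTT

variable (g : E → List G.Letter)

/-- Action of a map of `Γ` on edge paths in `Γ`. -/
noncomputable def gWord (w : List G.Letter) : List G.Letter := mapWord g (fun _ => []) w

/-- The initial direction of the image of a direction. -/
noncomputable def dirMap (x : G.Letter) : G.Letter := (gWord g [x]).headD x

/-- The turn between two directions (= oriented edges with common initial vertex) is legal: it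
never becomes degenerate. -/
def TurnLegal (x y : G.Letter) : Prop := ∀ n : ℕ, (dirMap g)^[n] x ≠ (dirMap g)^[n] y

/-- The stratum `k` of the filtration given by `ht` is exponentially growing: its (irreducible)
transition matrix has Perron-Frobenius eigenvalue `> 1`. -/
def ExpStratum (ht : E → ℕ) (k : ℕ) : Prop :=
  (∃ e, ht e = k) ∧ ∃ K : ℝ, 1 < K ∧ ∃ v : E → ℝ, (∀ e, ht e = k → 0 < v e) ∧
    ∀ e, ht e = k → ∑ᶠ (e') (_ : ht e' = k), (crossings (g e) e' : ℝ) * v e' = K * v e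

/-- `g` is a relative train track map of `Γ`.  The filtration is given by the function `ht`: the
`k`-th subgraph consists of the edges `e` with `ht e ≤ k`. -/
structure IsRelativeTrainTrack (gV : V → V) : Prop where
  /-- `g` maps edges to non-trivial reduced edge paths -/
  edge : ∀ e, IsEdgePath (gV (G.src e)) (g e) (gV (G.tgt e)) ∧ (∀ x ∈ g e, x.InΓ) ∧
    g e ≠ [] ∧ Reduced (g e)
  strata : ∃ ht : E → ℕ,
    (∀ e, ∀ x ∈ g e, x.On (fun e' => ht e' ≤ ht e)) ∧
    /- the transition matrix of every stratum is zero or irreducible -/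
    (∀ k, (∀ e e', ht e = k → ht e' = k → crossings (g e) e' = 0) ∨
      (∀ e e', ht e = k → ht e' = k →
        Relation.TransGen (fun c d => ht c = k ∧ ht d = k ∧ crossings (g c) d ≠ 0) e e')) ∧
    ∀ k, ExpStratum g ht k →
      /- directions in the stratum are mapped to directions in the stratum -/
      (∀ x : G.Letter, x.Full → x.On (fun e => ht e = k) →
        (dirMap g x).On (fun e => ht e = k)) ∧
      /- non-trivial connecting paths are mapped to non-trivial paths -/
      (∀ p q w, IsEdgePath p w q → (∀ x ∈ w, x.On (fun e => ht e < k)) → Reduced w → w ≠ [] →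
        (∃ e, ht e = k ∧ (G.src e = p ∨ G.tgt e = p)) →
        (∃ e, ht e = k ∧ (G.src e = q ∨ G.tgt e = q)) →
        ¬ HomΓ (.vert (gV p)) (.vert (gV q)) (gWord g w) []) ∧
      /- the image of a legal path in the stratum has no illegal turn in the stratum -/
      (∀ p q w, IsEdgePath p w q → (∀ x ∈ w, x.On (fun e => ht e = k)) →
        w.IsChain (fun x y => TurnLegal g x.inv y) →
        (gWord g w).IsChain (fun x y => x.On (fun e => ht e = k) → y.On (fun e => ht e = k) →
          TurnLegal g x.inv y))

end RTT

end Skeleton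

open Skeleton

/-- The data of a partial train track map with Nielsen faces `f : G² → G²`.  The 2-cells of `G²`
are the Nielsen faces, one for every auxiliary edge `x`, glued along the loop that runs through the
path `eta x` and back through `x`. -/
structure TrackMap (V : Type u₁) (E : Type u₂) (H : Type u₃) (C : Type u₄) extends
    Skeleton V E H C where
  /-- the INP associated to an auxiliary edge -/
  eta : toSkeleton.Aux → List toSkeleton.Letter
  /-- the retraction `r` onto `Γ` is this power of the map that replaces `x` by `eta x` -/
  depth : ℕ
  /-- the map `f` on vertices -/
  fV : V → V
  /-- the map `f` on edges of `Γ` -/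
  fE : E → List toSkeleton.Letter
  /-- the map `f` on auxiliary edges -/
  fA : toSkeleton.Aux → List toSkeleton.Letter

namespace TrackMap

variable (T : TrackMap V E H C)

/-- Words in the letters of the 1-skeleton. -/
abbrev Word := List T.toSkeleton.Letter

/-- Homotopy relative endpoints in the 2-complex `G²`: homotopies in the 1-skeleton, and pushing an
auxiliary edge over its Nielsen face. -/
def HomG2 (p q : T.toSkeleton.Pt) (w w' : T.Word) : Prop :=
  Homotopic (fun l l' => GraphMove l l' ∨ ∃ x, l = [.aux x] ∧ l' = T.eta x) p q w w'

/-- Replacing an auxiliary edge by the associated INP. -/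
def rhatLetter : T.toSkeleton.Letter → T.Word
  | .seg e a b => [.seg e a b]
  | .aux x => T.eta x

/-- The map `r̂`, on paths: it is the identity on `Γ` and maps every auxiliary edge to the
associated INP. -/
def rhat (w : T.Word) : T.Word := w.flatMap T.rhatLetter

/-- The retraction `r` onto `Γ`, on paths. -/
def r (w : T.Word) : T.Word := T.rhat^[T.depth] w

/-- The map `f`, on edge paths. -/
noncomputable def f (w : T.Word) : T.Word := mapWord T.fE T.fA w

/-- The edge path `u` from `p` to `q` is relatively backtracking. -/
def RelBacktracking (p q : V) (u : T.Word) : Prop :=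
  ∃ v : T.Word, IsEdgePath p v q ∧ (∀ x ∈ v, x.InX) ∧ T.HomG2 (.vert p) (.vert q) u v

/-- Relatively reduced edge paths. -/
def RelReduced (w : T.Word) : Prop :=
  ∀ (u : T.Word) (p q : V), u <:+: w → IsEdgePath p u q → T.RelBacktracking p q u →
    ∀ x ∈ u, x.InX

/-- Legal edge paths. -/
def Legal (w : T.Word) : Prop := ∀ t : ℕ, 1 ≤ t → T.RelReduced (T.f^[t] w)

/-- `eta` is an INP from `p` to `q`. -/
structure IsINP (p q : V) (η : T.Word) : Prop where
  path : IsEdgePath p η q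
  reduced : Reduced η
  first : ∃ x ∈ η.head?, x.InHat
  last : ∃ x ∈ η.getLast?, x.InHat
  branches : ∃ η' η'' : T.Word, η = η' ++ η'' ∧ T.Legal η' ∧ T.Legal η''
  not_legal : ∀ t : ℕ, ¬ T.Legal (T.f^[t] η)
  periodic : ∃ t : ℕ, 1 ≤ t ∧ HomG1 (.vert p) (.vert q) (T.f^[t] η) η

/-- Strongly legal edge paths: the path is legal, and after replacing every auxiliary edge by the
associated INP, the only turns that are not legal are those of the inserted INPs (every INP has
precisely one such turn, its tip). -/
def StronglyLegal (w : T.Word) : Prop :=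
  XReduced w ∧ T.Legal w ∧
  ∀ (u : T.Word) (x : T.toSkeleton.Letter) (χ : T.Word) (y : T.toSkeleton.Letter) (v : T.Word),
    T.rhat w = u ++ (x :: χ ++ [y]) ++ v → x.InHat → y.InHat → (∀ z ∈ χ, z.InX) →
    ¬ T.Legal (x :: χ ++ [y]) →
    ∃ (w₁ : T.Word) (k : T.toSkeleton.Aux) (w₂ a b : T.Word),
      w = w₁ ++ [.aux k] ++ w₂ ∧ T.eta k = a ++ (x :: χ ++ [y]) ++ b ∧
      u = T.rhat w₁ ++ a ∧ v = b ++ T.rhat w₂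

/-- The turn `x χ y` is illegal: it is not legal, or one of its two half turns is not strongly
legal. -/
def IllegalTurn (x : T.toSkeleton.Letter) (χ : T.Word) (y : T.toSkeleton.Letter) : Prop :=
  ¬ T.Legal (x :: χ ++ [y]) ∨ ¬ T.StronglyLegal (x :: χ) ∨ ¬ T.StronglyLegal (χ ++ [y])

/-- The number of illegal turns of an edge path. -/
noncomputable def ILT (w : T.Word) : ℕ :=
  Set.ncard {n : ℕ | ∃ (u : T.Word) (x : T.toSkeleton.Letter) (χ : T.Word)
    (y : T.toSkeleton.Letter) (v : T.Word), w = u ++ (x :: χ ++ [y]) ++ v ∧ u.length = n ∧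
      x.InHat ∧ y.InHat ∧ (∀ z ∈ χ, z.InX) ∧ T.IllegalTurn x χ y}

/-- The loop `w` at `p` and the loop `w'` at `q` are freely homotopic in `G²`. -/
def FreelyHomotopic (p q : V) (w w' : T.Word) : Prop :=
  ∃ c : T.Word, IsEdgePath p c q ∧ T.HomG2 (.vert p) (.vert p) w (c ++ w' ++ invW c)

/-- The lift of the edge path `w` to the universal covering of `G²` is a quasi-geodesic, with
constants `K` and `M`, for the simplicial metric. -/
def QuasiGeodesic (K M : ℝ) (w : T.Word) : Prop :=
  ∀ (u v : T.Word) (p q : V), u <:+: w → IsEdgePath p u q → IsEdgePath p v q →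
    T.HomG2 (.vert p) (.vert q) u v → (u.length : ℝ) ≤ K * v.length + M

/-- `f : G² → G²` is a partial train track map with Nielsen faces which represents an automorphism
of a free group of finite rank; the Nielsen faces correspond to the INPs of `f`. -/
structure IsPartialTrainTrack : Prop where
  finite_V : Finite V
  finite_E : Finite E
  finite_H : Finite H
  nonempty : Nonempty V
  connected : ∀ p q : V, ∃ w : T.Word, IsEdgePath p w q
  /- the auxiliary edges and the retraction -/
  eta_inv : ∀ x, T.eta x.inv = invW (T.eta x)
  eta_INP : ∀ x : T.toSkeleton.Aux, T.IsINP (T.foot x.i) (T.foot x.t) (T.eta x)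
  INP_eta : ∀ p q η, T.IsINP p q η → ∃ x, T.eta x = η
  r_inΓ : ∀ x, ∀ y ∈ T.r [.aux x], y.InΓ
  r_reduced : ∀ x, Reduced (T.r [.aux x])
  /-- `r` is compatible with the identifications in the stars of auxiliary half-edges -/
  r_star : ∀ x y z : T.toSkeleton.Aux, x.t = y.i → z.i = x.i → z.t = y.t →
    HomΓ (.vert (T.foot z.i)) (.vert (T.foot z.t)) (T.r [.aux x, .aux y]) (T.r [.aux z])
  /- the map `f` is a well defined map of `G²` which maps `X` to `X` -/
  fE_path : ∀ e, IsEdgePath (T.fV (T.src e)) (T.fE e) (T.fV (T.tgt e))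
  fA_path : ∀ x : T.toSkeleton.Aux,
    IsEdgePath (T.fV (T.foot x.i)) (T.fA x) (T.fV (T.foot x.t))
  fE_inX : ∀ e, e ∉ T.hat → ∀ y ∈ T.fE e, y.InX
  fA_inX : ∀ x, ∀ y ∈ T.fA x, y.InX
  fA_inv : ∀ x, T.fA x.inv = invW (T.fA x)
  f_star : ∀ x y z : T.toSkeleton.Aux, x.t = y.i → z.i = x.i → z.t = y.t →
    HomX (.vert (T.fV (T.foot z.i))) (.vert (T.fV (T.foot z.t)))
      (T.f [.aux x, .aux y]) (T.f [.aux z])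
  f_face : ∀ x : T.toSkeleton.Aux,
    T.HomG2 (.vert (T.fV (T.foot x.i))) (.vert (T.fV (T.foot x.t)))
      (T.f [.aux x]) (T.f (T.eta x))
  /- `f` induces an isomorphism of fundamental groups -/
  f_injective : ∀ (p : V) (w : T.Word), IsEdgePath p w p →
    T.HomG2 (.vert (T.fV p)) (.vert (T.fV p)) (T.f w) [] → T.HomG2 (.vert p) (.vert p) w []
  f_surjective : ∀ (p : V) (u : T.Word), IsEdgePath (T.fV p) u (T.fV p) →
    ∃ w : T.Word, IsEdgePath p w p ∧ T.HomG2 (.vert (T.fV p)) (.vert (T.fV p)) (T.f w) u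
  /- the partial train track property -/
  edge_legal : ∀ e ∈ T.hat, T.Legal [.seg e 0 1]
  /-- paths have an iterate which is homotopic to a legal path -/
  path_legal : ∀ (p q : V) (w : T.Word), IsEdgePath p w q → ∃ (t : ℕ) (w' : T.Word),
    IsEdgePath (T.fV^[t] p) w' (T.fV^[t] q) ∧ T.Legal w' ∧
    T.HomG2 (.vert (T.fV^[t] p)) (.vert (T.fV^[t] q)) (T.f^[t] w) w'
  /-- loops have an iterate which is freely homotopic to a legal loop (i.e. all paths that wind
  around the loop are legal) -/
  loop_legal : ∀ (p : V) (w : T.Word), IsEdgePath p w p → ∃ (t : ℕ) (q : V) (w' : T.Word),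
    IsEdgePath q w' q ∧ (∀ n : ℕ, T.Legal (List.replicate n w').flatten) ∧
    T.FreelyHomotopic (T.fV^[t] p) q (T.f^[t] w) w'

/-- `f : G² → G²` is a beta-train track map (representing an automorphism of a free group of finite
rank). -/
structure IsBetaTrainTrack : Prop extends T.IsPartialTrainTrack where
  /-- the components of `X` inject on fundamental groups -/
  X_injective : ∀ (p : V) (w : T.Word), IsEdgePath p w p → (∀ x ∈ w, x.InX) →
    T.HomG2 (.vert p) (.vert p) w [] → HomX (.vert p) (.vert p) w []
  /-- loops in `X` have polynomial growth -/
  X_polynomial : ∀ (p : V) (w : T.Word), IsEdgePath p w p → (∀ x ∈ w, x.InX) →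
    ∃ (K : ℝ) (d : ℕ), 0 < K ∧ ∀ t : ℕ, 1 ≤ t → ∃ (q : V) (u : T.Word), IsEdgePath q u q ∧
      T.FreelyHomotopic (T.fV^[t] p) q (T.f^[t] w) u ∧ (u.length : ℝ) ≤ K * (t : ℝ) ^ d
  /-- the composition of `f` and `r` is (after tightening the images of the edges) a relative
  train track map of `Γ` -/
  relative_train_track : ∃ g : E → T.Word,
    (∀ e, HomΓ (.vert (T.fV (T.src e))) (.vert (T.fV (T.tgt e))) (T.r (T.fE e)) (g e)) ∧
    IsRelativeTrainTrack g T.fV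
  edge_stronglyLegal : ∀ e ∈ T.hat, T.StronglyLegal [.seg e 0 1]
  /-- strongly legal paths are mapped to strongly legal paths (subpaths in `X` are only considered
  up to homotopy in `X`) -/
  f_stronglyLegal : ∀ (p q : V) (w : T.Word), IsEdgePath p w q → T.StronglyLegal w →
    ∃ w' : T.Word, IsEdgePath (T.fV p) w' (T.fV q) ∧ T.StronglyLegal w' ∧
      HomX (.vert (T.fV p)) (.vert (T.fV q)) (T.f w) w'
  expanding : ∀ e ∈ T.hat, ∃ t : ℕ, 1 ≤ t ∧ ∃ (u₁ u₂ u₃ : T.Word) (x y : T.toSkeleton.Letter),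
    T.f^[t] [.seg e 0 1] = u₁ ++ [x] ++ u₂ ++ [y] ++ u₃ ∧ x.InHat ∧ y.InHat
  stronglyLegal_quasiGeodesic : ∃ K M : ℝ, ∀ (p q : V) (w : T.Word), IsEdgePath p w q →
    T.StronglyLegal w → T.QuasiGeodesic K M w
  reduced_quasiGeodesic : ∃ K M : ℝ, ∀ (p q : V) (w : T.Word), IsEdgePath p w q →
    (∀ x ∈ w, x.InΓ) → Reduced w → T.QuasiGeodesic K M w
  retract_quasiGeodesic : ∃ K M : ℝ, ∀ (p q : V) (w : T.Word), IsEdgePath p w q →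
    Reduced (T.r w) → T.QuasiGeodesic K M w
  /-- applying `r` to some subpaths of a strongly legal path gives a quasi-geodesic -/
  mixed_quasiGeodesic : ∃ K M : ℝ, ∀ (p q : V) (w : T.Word) (L : List T.Word),
    IsEdgePath p w q → T.StronglyLegal w →
    List.Forall₂ (fun x l => l = [x] ∨ l = T.r [x]) w L → T.QuasiGeodesic K M L.flatten
  /-- every path has an iterate that is homotopic to a strongly legal path; the exponent depends
  only on the number of illegal turns -/
  path_stronglyLegal : ∃ τ : ℕ → ℕ, ∀ (p q : V) (w : T.Word), IsEdgePath p w q → XReduced w →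
    ∃ w' : T.Word, IsEdgePath (T.fV^[τ (T.ILT w)] p) w' (T.fV^[τ (T.ILT w)] q) ∧
      T.StronglyLegal w' ∧
      T.HomG2 (.vert (T.fV^[τ (T.ILT w)] p)) (.vert (T.fV^[τ (T.ILT w)] q))
        (T.f^[τ (T.ILT w)] w) w'

/-! ### Normalized paths -/

/-- The pre-INP `r(x)` occurs in the path `ρ` in `Γ`, as the subpath that starts after `n`
letters. -/
def OccursAt (ρ : T.Word) (n : ℕ) (x : T.toSkeleton.Aux) : Prop :=
  ∃ u v : T.Word, ρ = u ++ T.r [.aux x] ++ v ∧ u.length = n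

/-- The pre-INP `r(x)` that occurs in `ρ` after `n` letters is isolated: any other pre-INP in `ρ`
that intersects it in more than a point is contained in it. -/
def IsolatedAt (ρ : T.Word) (n : ℕ) (x : T.toSkeleton.Aux) : Prop :=
  T.OccursAt ρ n x ∧ ∀ (m : ℕ) (y : T.toSkeleton.Aux), T.OccursAt ρ m y →
    max n m < min (n + (T.r [.aux x]).length) (m + (T.r [.aux y]).length) →
    n ≤ m ∧ m + (T.r [.aux y]).length ≤ n + (T.r [.aux x]).length

/-- `w` is obtained from the path `ρ` in `Γ` through replacing every isolated pre-INP `r(x)` (and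
nothing else) by the auxiliary edge `x`: re-substituting `r(x)` for the auxiliary edges `x` of `w`
gives back `ρ`, and the places in `ρ` of these `r(x)` are exactly those of the isolated pre-INPs. -/
def IsReplacement (ρ w : T.Word) : Prop :=
  T.r w = ρ ∧ ∀ (n : ℕ) (x : T.toSkeleton.Aux),
    (∃ w₁ w₂ : T.Word, w = w₁ ++ [.aux x] ++ w₂ ∧ (T.r w₁).length = n) ↔ T.IsolatedAt ρ n x

/-- Normalized paths. -/
def Normalized (w : T.Word) : Prop := Reduced (T.r w) ∧ T.IsReplacement (T.r w) w

end TrackMap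

end BetaTT

namespace BetaTT

open Skeleton

universe u₁ u₂ u₃ u₄

variable {V : Type u₁} {E : Type u₂} {H : Type u₃} {C : Type u₄}

namespace Skeleton

variable {G : Skeleton V E H C}

/-! ### Paths and homotopies -/

/-! Replacing auxiliary edges by INPs pushes them over Nielsen faces, so every path `w` is homotopic
in the 2-complex to `r w`, a path in `Γ`. For existence, tighten `r γ` to a reduced path `ρ` in `Γ`
and put auxiliary edges in place of its isolated pre-INPs. This is possible because distinct
isolated pre-INPs do not overlap (`isolatedAt_disjoint`): two overlapping ones contain each other,
hence coincide as words, and a pre-INP determines its auxiliary edge by `π₁`-injectivity of `X`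
(`r_aux_injective`).

For uniqueness, a free group valued invariant, `holonomy`, separates reduced words and is constant
on 2-complex homotopy classes after applying `r` (`holonomy_r_eq`). So homotopic normalized paths
have the same retraction `ρ`. The isolated pre-INPs of `ρ` then fix the positions of the auxiliary
edges, and these data fix the word (`eq_of_auxAt_iff`).

A normalized path is reduced in `X` because two consecutive auxiliary edges sharing a half-edge
would give a longer pre-INP, which contradicts isolation (`xReduced_of_normalized`). -/

theorem isPath_append {p q : G.Pt} {u v : List G.Letter} :
    IsPath p (u ++ v) q ↔ ∃ m, IsPath p u m ∧ IsPath m v q := by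
  induction u generalizing p with
  | nil => simp [IsPath]
  | cons x u ih => simp [IsPath, ih, and_assoc]

theorem IsPath.eq_of_ne_nil {p q p' q' : G.Pt} {w : List G.Letter} (h : IsPath p w q)
    (h' : IsPath p' w q') (hw : w ≠ []) : p = p' ∧ q = q' := by
  have key : ∀ (w : List G.Letter) (p q q' : G.Pt), IsPath p w q → IsPath p w q' → q = q' := by
    intro w
    induction w with
    | nil => intro p q q' h h'; exact h.symm.trans h'
    | cons x w ih => intro p q q' h h'; exact ih _ _ _ h.2 h'.2
  cases w with
  | nil => exact absurd rfl hw
  | cons x w => exact ⟨h.1.symm.trans h'.1, key _ _ _ _ h.2 h'.2⟩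

section Homotopic

variable {R : List G.Letter → List G.Letter → Prop} {p q : G.Pt} {w w' w'' : List G.Letter}

theorem Homotopic.symm (h : Homotopic R p q w w') : Homotopic R p q w' w :=
  ⟨h.2.1, h.1, h.2.2.symm⟩

theorem Homotopic.trans (h : Homotopic R p q w w') (h' : Homotopic R p q w' w'') :
    Homotopic R p q w w'' :=
  ⟨h.1, h'.2.1, h.2.2.trans _ _ _ h'.2.2⟩

theorem Homotopic.refl (h : IsPath p w q) : Homotopic R p q w w :=
  ⟨h, h, .refl _⟩

theorem Homotopic.of_rel {l l' : List G.Letter} (h : R l l') (hl : IsPath p l q)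
    (hl' : IsPath p l' q) : Homotopic R p q l l' :=
  ⟨hl, hl', .rel _ _ ⟨hl, hl', [], [], l, l', h, by simp, by simp⟩⟩

theorem Homotopic.context {m n : G.Pt} {u v : List G.Letter} (h : Homotopic R m n w w')
    (hu : IsPath p u m) (hv : IsPath n v q) : Homotopic R p q (u ++ w ++ v) (u ++ w' ++ v) := by
  have path : ∀ {c}, IsPath m c n → IsPath p (u ++ c ++ v) q := fun hc =>
    isPath_append.2 ⟨n, isPath_append.2 ⟨m, hu, hc⟩, hv⟩
  obtain ⟨h₁, h₂, h⟩ := h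
  refine ⟨path h₁, path h₂, ?_⟩
  clear h₁ h₂
  induction h with
  | rel c d hcd =>
    obtain ⟨hc, hd, a, b, l, l', hl, rfl, rfl⟩ := hcd
    exact .rel _ _ ⟨path hc, path hd, u ++ a, b ++ v, l, l', hl, by simp, by simp⟩
  | refl => exact .refl _
  | symm _ _ _ ih => exact .symm _ _ ih
  | trans _ _ _ _ _ ih ih' => exact .trans _ _ _ ih ih'

/-- Since invariance is only asked of the generating moves in context, this turns the local
relations of `holonomy` into invariance under homotopy. -/
theorem Homotopic.invariant {α : Type*} {F : List G.Letter → α} (h : Homotopic R p q w w')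
    (hF : ∀ u v l l', R l l' → F (u ++ l ++ v) = F (u ++ l' ++ v)) : F w = F w' := by
  obtain ⟨-, -, h⟩ := h
  induction h with
  | rel c d hcd =>
    obtain ⟨-, -, a, b, l, l', hl, rfl, rfl⟩ := hcd
    exact hF _ _ _ _ hl
  | refl => rfl
  | symm _ _ _ ih => exact ih.symm
  | trans _ _ _ _ _ ih ih' => exact ih.trans ih'

end Homotopic

/-! ### A free group valued invariant of homotopy classes in the 1-skeleton -/

/-- The free generator attached to the beginning of a letter. -/
def Letter.startGen : G.Letter → (E × unitInterval) ⊕ H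
  | .seg e a _ => .inl (e, a)
  | .aux x => .inr x.i

/-- The free generator attached to the end of a letter. -/
def Letter.finishGen : G.Letter → (E × unitInterval) ⊕ H
  | .seg e _ b => .inl (e, b)
  | .aux x => .inr x.t

/-- Every letter is spelled as the inverse of a generator, followed by a generator. -/
def spell (w : List G.Letter) : List (((E × unitInterval) ⊕ H) × Bool) :=
  w.flatMap fun x => [(x.startGen, false), (x.finishGen, true)]

/-- The element of the free group represented by a word. -/
def holonomy (w : List G.Letter) : FreeGroup ((E × unitInterval) ⊕ H) :=
  FreeGroup.mk (spell w)

theorem holonomy_nil : holonomy ([] : List G.Letter) = 1 := rfl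

theorem holonomy_append (u v : List G.Letter) : holonomy (u ++ v) = holonomy u * holonomy v := by
  simp [holonomy, spell, FreeGroup.mul_mk]

theorem holonomy_singleton (x : G.Letter) :
    holonomy [x] = (FreeGroup.of x.startGen)⁻¹ * FreeGroup.of x.finishGen := rfl

theorem holonomy_cons (x : G.Letter) (w : List G.Letter) :
    holonomy (x :: w) =
      (FreeGroup.of x.startGen)⁻¹ * FreeGroup.of x.finishGen * holonomy w := by
  rw [← holonomy_singleton, ← holonomy_append, List.singleton_append]

/-- A letter from `s` to `t` contributes `s⁻¹ t`, so contributions that meet at a common generator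
telescope. -/
theorem GraphMove.holonomy_eq {l l' : List G.Letter} (h : GraphMove l l') :
    holonomy l = holonomy l' := by
  cases h <;>
    simp_all [holonomy_cons, holonomy_nil, Letter.startGen, Letter.finishGen, Aux.inv, mul_assoc]

theorem Letter.startGen_inv (x : G.Letter) : x.inv.startGen = x.finishGen := by
  cases x <;> rfl

theorem Letter.finishGen_inv (x : G.Letter) : x.inv.finishGen = x.startGen := by
  cases x <;> rfl

theorem invW_append (u v : List G.Letter) : invW (u ++ v) = invW v ++ invW u := by
  simp [invW]

theorem holonomy_invW (w : List G.Letter) : holonomy (invW w) = (holonomy w)⁻¹ := by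
  induction w with
  | nil => rfl
  | cons x w ih =>
    rw [← List.singleton_append, invW_append, holonomy_append, holonomy_append, ih, mul_inv_rev]
    congr 1
    simp [invW, holonomy_singleton, Letter.startGen_inv, Letter.finishGen_inv]

theorem spell_injective : Function.Injective (spell : List G.Letter → _) := by
  intro w
  induction w with
  | nil => intro w' h; cases w' <;> simp_all [spell]
  | cons x w ih =>
    intro w' h
    cases w' with
    | nil => simp [spell] at h
    | cons y w' =>
      simp only [spell, List.flatMap_cons, List.cons_append, List.nil_append, List.cons.injEq,
        Prod.mk.injEq, and_true] at h
      obtain ⟨h₁, h₂, h₃⟩ := h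
      rw [ih h₃]
      congr 1
      cases x <;> cases y <;> simp_all [Letter.startGen, Letter.finishGen]
      exact Aux.ext h₁ h₂

/-! ### Reduced words are determined by their holonomy -/

/-- No letter of the word is a constant segment. -/
def Nonconst (w : List G.Letter) : Prop := ∀ e a b, Letter.seg e a b ∈ w → a ≠ b

/-- Cancellation inside one letter would need equal ends: a constant segment, or an auxiliary edge
with equal half-edges. Cancellation between two letters is exactly backtracking. -/
theorem isReduced_spell {w : List G.Letter} (hw : Reduced w) (hc : Nonconst w) :
    FreeGroup.IsReduced (spell w) := by
  induction w with
  | nil => exact List.isChain_nil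
  | cons x w ih =>
    have hx : x.startGen ≠ x.finishGen := by
      cases x with
      | seg e a b => simpa [Letter.startGen, Letter.finishGen] using hc e a b (by simp)
      | aux x => simpa [Letter.startGen, Letter.finishGen] using x.ne
    have ih := ih hw.tail (fun e a b h => hc e a b (by simp [h]))
    cases w with
    | nil => simpa [spell, FreeGroup.IsReduced] using hx
    | cons y w =>
      have hxy : x.finishGen ≠ y.startGen := by
        have := (List.isChain_cons_cons.1 hw).1
        cases x <;> cases y <;>
          simp_all [Letter.startGen, Letter.finishGen, Backtrack]
      simp_all [spell, FreeGroup.IsReduced]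

/-- An element of a free group has only one reduced spelling, and the spelling gives back the word.
-/
theorem eq_of_holonomy_eq {w w' : List G.Letter} (hw : Reduced w) (hc : Nonconst w)
    (hw' : Reduced w') (hc' : Nonconst w') (h : holonomy w = holonomy w') : w = w' := by
  classical
  apply spell_injective
  rw [← (isReduced_spell hw hc).reduce_eq, ← (isReduced_spell hw' hc').reduce_eq]
  exact FreeGroup.reduce.sound h

theorem IsGPath.nonconst {p q : G.Pt} {w : List G.Letter} (h : IsGPath p w q) : Nonconst w :=
  fun e a b hm => (h.2.1 e a b hm).1

theorem Letter.Full.exists_finish {x : G.Letter} (h : x.Full) : ∃ v, x.finish = .vert v := by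
  cases x with
  | seg e a b => rcases h with ⟨rfl, rfl⟩ | ⟨rfl, rfl⟩ <;> simp [Letter.finish, point]
  | aux x => exact ⟨_, rfl⟩

theorem nonconst_of_full {w : List G.Letter} (h : ∀ x ∈ w, x.Full) : Nonconst w := by
  rintro e a b hm rfl
  rcases h _ hm with ⟨h₀, h₁⟩ | ⟨h₁, h₀⟩ <;> exact zero_ne_one (h₀.symm.trans h₁)

/-! ### Tightening paths in `Γ` -/

/-- A path in `Γ` that backtracks can be shortened. -/
theorem IsGPath.exists_shorter {p q : G.Pt} {w : List G.Letter} (h : IsGPath p w q)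
    (hΓ : ∀ x ∈ w, x.InΓ) (hw : ¬ Reduced w) :
    ∃ w', IsGPath p w' q ∧ (∀ x ∈ w', x.InΓ) ∧ HomG1 p q w w' ∧ w'.length < w.length := by
  obtain ⟨u, x, y, v, rfl, hb⟩ : ∃ u x y v, w = u ++ x :: y :: v ∧ Backtrack x y := by
    by_contra hcon
    push Not at hcon
    exact hw (List.isChain_iff_forall_rel_of_append_cons_cons.2
      fun a b l₁ l₂ hl => hcon _ _ _ _ hl)
  obtain ⟨e, a, b, rfl⟩ : ∃ e a b, x = Letter.seg e a b := by
    cases x with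
    | seg e a b => exact ⟨e, a, b, rfl⟩
    | aux x => exact (hΓ (.aux x) (by simp)).elim
  obtain ⟨c, rfl⟩ : ∃ c, y = Letter.seg e b c := by
    cases y with
    | seg e' b' c => obtain ⟨rfl, rfl⟩ := hb; exact ⟨c, rfl⟩
    | aux x => exact hb.elim
  obtain ⟨hp, hs, hch⟩ := h
  obtain ⟨m, hu, hm, hn, hv⟩ := isPath_append.1 hp
  simp only [Letter.finish, Letter.start] at hm hn hv
  obtain ⟨hch₁, hch₂, hch₃⟩ := List.isChain_append.1 hch
  obtain ⟨hfin, hch₂⟩ := List.isChain_cons_cons.1 hch₂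
  obtain ⟨hch₄, hch₅⟩ := List.isChain_cons.1 hch₂
  have hull : ∀ z ∈ u.getLast?, ∃ v, z.finish = .vert v := fun z hz => hch₃ z hz _ rfl
  have base : HomG1 p q (u ++ .seg e a b :: .seg e b c :: v) (u ++ [.seg e a c] ++ v) := by
    have := Homotopic.context (R := GraphMove) (Homotopic.of_rel (GraphMove.merge (G := G) e a b c)
      (p := m) (q := G.point e c) ⟨hm, rfl, rfl⟩ ⟨hm, rfl⟩) hu hv
    simpa [HomG1] using this
  by_cases hac : a = c
  -- The backtracking is complete: the merged segment is constant and is deleted.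
  · subst hac
    refine ⟨u ++ v, ⟨?_, ?_, ?_⟩, ?_, ?_, ?_⟩
    · exact isPath_append.2 ⟨m, hu, hm ▸ hv⟩
    · intro e' a' b' hm'
      exact hs e' a' b' (by simp at hm' ⊢; tauto)
    · exact List.isChain_append.2 ⟨hch₁, hch₅, fun z hz _ _ => hull z hz⟩
    · intro z hz
      exact hΓ z (by simp at hz ⊢; tauto)
    · refine base.trans ?_
      have := Homotopic.context (R := GraphMove) (Homotopic.of_rel (GraphMove.const (G := G) e a)
        (p := m) (q := G.point e a) ⟨hm, rfl⟩ hm.symm) hu hv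
      simpa [HomG1] using this
    · simp
  · refine ⟨u ++ [.seg e a c] ++ v, ⟨?_, ?_, ?_⟩, ?_, base, by simp⟩
    · exact base.2.1
    · intro e' a' b' hm'
      by_cases hold : Letter.seg e' a' b' ∈ u ++ .seg e a b :: .seg e b c :: v
      · exact hs _ _ _ hold
      · have : e' = e ∧ a' = a ∧ b' = c := by
          simp at hm' hold; tauto
        obtain ⟨rfl, rfl, rfl⟩ := this
        refine ⟨hac, ?_⟩
        rcases (hs e' a' b (by simp)).2 with h₁ | h₁
        · exact .inl h₁
        rcases (hs e' b b' (by simp)).2 with h₂ | h₂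
        · exact .inl h₂
        -- Outside the train track part both segments are full; meeting at parameter `b`, they
        -- traverse the edge back and forth, so the merged segment would be constant.
        exfalso
        rcases h₁ with ⟨rfl, rfl⟩ | ⟨rfl, rfl⟩ <;> rcases h₂ with ⟨h, rfl⟩ | ⟨h, rfl⟩ <;>
          simp_all
    · rw [List.append_assoc, List.singleton_append]
      refine List.isChain_append.2 ⟨hch₁, List.isChain_cons.2 ⟨?_, hch₅⟩,
        fun z hz _ _ => hull z hz⟩
      -- The chain condition only sees where the left letter ends, and the merged segment ends where
      -- the second one did.
      intro z hz
      exact hch₄ z hz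
    · intro z hz
      by_cases hold : z ∈ u ++ .seg e a b :: .seg e b c :: v
      · exact hΓ z hold
      · have : z = .seg e a c := by simp at hz hold; tauto
        subst this; trivial

/-- Every path in `Γ` is homotopic to a reduced path in `Γ`. -/
theorem IsGPath.exists_reduced {p q : G.Pt} {w : List G.Letter} (h : IsGPath p w q)
    (hΓ : ∀ x ∈ w, x.InΓ) :
    ∃ w', IsGPath p w' q ∧ (∀ x ∈ w', x.InΓ) ∧ HomG1 p q w w' ∧ Reduced w' := by
  induction hn : w.length using Nat.strong_induction_on generalizing w with
  | _ n ih =>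
    by_cases hw : Reduced w
    · exact ⟨w, h, hΓ, .refl h.1, hw⟩
    · obtain ⟨w', h', hΓ', hh, hl⟩ := h.exists_shorter hΓ hw
      obtain ⟨w'', h₁, h₂, h₃, h₄⟩ := ih _ (hn ▸ hl) h' hΓ' rfl
      exact ⟨w'', h₁, h₂, hh.trans h₃, h₄⟩

end Skeleton

namespace TrackMap

variable {T : TrackMap V E H C}

theorem HomG2.of_homG1 {p q : T.toSkeleton.Pt} {w w' : T.Word} (h : HomG1 p q w w') :
    T.HomG2 p q w w' := by
  refine ⟨h.1, h.2.1, Relation.EqvGen.mono ?_ _ _ h.2.2⟩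
  rintro c d ⟨hc, hd, u, v, l, l', hl, h₁, h₂⟩
  exact ⟨hc, hd, u, v, l, l', .inl hl, h₁, h₂⟩

/-! ### The retraction onto `Γ` -/

theorem rhat_append (u v : T.Word) : T.rhat (u ++ v) = T.rhat u ++ T.rhat v := by
  simp [rhat]

theorem rhat_iterate_append (n : ℕ) (u v : T.Word) :
    T.rhat^[n] (u ++ v) = T.rhat^[n] u ++ T.rhat^[n] v := by
  induction n generalizing u v with
  | zero => rfl
  | succ n ih => simp only [Function.iterate_succ_apply, rhat_append, ih]

theorem r_append (u v : T.Word) : T.r (u ++ v) = T.r u ++ T.r v := rhat_iterate_append _ u v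

theorem r_cons (x : T.toSkeleton.Letter) (w : T.Word) : T.r (x :: w) = T.r [x] ++ T.r w := by
  rw [← r_append, List.singleton_append]

theorem rhat_of_inΓ {w : T.Word} (h : ∀ x ∈ w, x.InΓ) : T.rhat w = w := by
  induction w with
  | nil => rfl
  | cons x w ih =>
    cases x with
    | seg e a b =>
      have := ih (fun x hx => h x (by simp [hx]))
      simpa [rhat, rhatLetter] using this
    | aux x => exact (h (.aux x) (by simp)).elim

theorem r_of_inΓ {w : T.Word} (h : ∀ x ∈ w, x.InΓ) : T.r w = w :=
  Function.iterate_fixed (rhat_of_inΓ h) _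

theorem r_nil : T.r [] = [] := r_of_inΓ (by simp)

theorem r_seg (e : E) (a b : unitInterval) : T.r [.seg e a b] = [.seg e a b] :=
  r_of_inΓ (by simp [Letter.InΓ])

namespace IsPartialTrainTrack

variable (hT : T.IsPartialTrainTrack)

include hT

theorem eta_ne_nil (x : T.toSkeleton.Aux) : T.eta x ≠ [] := by
  obtain ⟨y, hy, -⟩ := (hT.eta_INP x).first
  rintro h
  simp [h] at hy

theorem rhat_ne_nil {w : T.Word} (hw : w ≠ []) : T.rhat w ≠ [] := by
  cases w with
  | nil => exact absurd rfl hw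
  | cons x w =>
    cases x with
    | seg e a b => simp [rhat, rhatLetter]
    | aux x => simp [rhat, rhatLetter, hT.eta_ne_nil x]

/-- INPs have a first edge, hence are not empty. So every letter of `w` occupies a nonempty piece of
`r w`, which makes positions in `r w` usable as addresses of letters of `w`. -/
theorem r_ne_nil {w : T.Word} (hw : w ≠ []) : T.r w ≠ [] := by
  unfold r
  generalize T.depth = n
  induction n generalizing w with
  | zero => exact hw
  | succ n ih => exact ih (hT.rhat_ne_nil hw)

theorem isPath_rhat {p q : T.toSkeleton.Pt} {w : T.Word} (h : IsPath p w q) :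
    IsPath p (T.rhat w) q := by
  induction w generalizing p with
  | nil => exact h
  | cons x w ih =>
    cases x with
    | seg e a b => exact ⟨h.1, ih h.2⟩
    | aux x =>
      refine isPath_append.2 ⟨_, ?_, ih h.2⟩
      have := (hT.eta_INP x).path.1
      exact h.1 ▸ this

theorem full_rhat {w : T.Word} (h : ∀ x ∈ w, x.Full) : ∀ x ∈ T.rhat w, x.Full := by
  intro y hy
  obtain ⟨x, hx, hy⟩ := List.mem_flatMap.1 hy
  cases x with
  | seg e a b =>
    obtain rfl : y = .seg e a b := by simpa [rhatLetter] using hy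
    exact h _ hx
  | aux x => exact (hT.eta_INP x).path.2 y hy

theorem isEdgePath_r_aux (x : T.toSkeleton.Aux) :
    IsEdgePath (T.foot x.i) (T.r [.aux x]) (T.foot x.t) := by
  unfold r
  generalize T.depth = n
  induction n with
  | zero => exact ⟨⟨rfl, rfl⟩, by simp [Letter.Full]⟩
  | succ n ih =>
    rw [Function.iterate_succ_apply']
    exact ⟨hT.isPath_rhat ih.1, hT.full_rhat ih.2⟩

theorem isGPath_rhat {p q : T.toSkeleton.Pt} {w : T.Word} (h : IsGPath p w q) :
    IsGPath p (T.rhat w) q := by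
  obtain ⟨hp, hs, hc⟩ := h
  refine ⟨hT.isPath_rhat hp, ?_, ?_⟩
  · intro e a b hm
    obtain ⟨x, hx, hm⟩ := List.mem_flatMap.1 hm
    cases x with
    | seg e' a' b' =>
      obtain ⟨rfl, rfl, rfl⟩ : e = e' ∧ a = a' ∧ b = b' := by simpa [rhatLetter] using hm
      exact hs _ _ _ hx
    | aux x =>
      have hf := (hT.eta_INP x).path.2
      exact ⟨nonconst_of_full hf e a b hm, .inr (hf _ hm)⟩
  · clear hp hs
    induction w with
    | nil => exact hc
    | cons x w ih =>
      obtain ⟨hc₁, hc₂⟩ := List.isChain_cons.1 hc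
      cases x with
      | seg e a b =>
        refine List.isChain_cons.2 ⟨?_, ih hc₂⟩
        intro y hy
        cases w with
        | nil => simp at hy
        | cons z w => exact hc₁ z rfl
      | aux x =>
        have hf := (hT.eta_INP x).path.2
        refine List.isChain_append.2 ⟨?_, ih hc₂, ?_⟩
        · exact List.isChain_iff_forall_rel_of_append_cons_cons.2 fun a b l₁ l₂ hl =>
            (hf a (by simp [rhatLetter] at hl; simp [hl])).exists_finish
        · intro y hy _ _
          exact (hf y (List.mem_of_getLast? hy)).exists_finish

theorem isGPath_r {p q : T.toSkeleton.Pt} {w : T.Word} (h : IsGPath p w q) :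
    IsGPath p (T.r w) q := by
  unfold r
  generalize T.depth = n
  induction n generalizing w with
  | zero => exact h
  | succ n ih => exact ih (hT.isGPath_rhat h)

theorem inΓ_r (w : T.Word) : ∀ y ∈ T.r w, y.InΓ := by
  induction w with
  | nil => simp [r_nil]
  | cons x w ih =>
    rw [r_cons]
    intro y hy
    rcases List.mem_append.1 hy with hy | hy
    · cases x with
      | seg e a b =>
        obtain rfl : y = .seg e a b := by simpa [r_seg] using hy
        trivial
      | aux x => exact hT.r_inΓ x y hy
    · exact ih y hy

theorem homG2_rhat {p q : T.toSkeleton.Pt} {w : T.Word} (h : IsPath p w q) :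
    T.HomG2 p q w (T.rhat w) := by
  induction w generalizing p with
  | nil => exact .refl h
  | cons x w ih =>
    have h₁ := Homotopic.context (ih h.2) (p := p) (q := q) (u := [x]) (v := []) ⟨h.1, rfl⟩ rfl
    simp only [List.append_nil, List.singleton_append] at h₁
    cases x with
    | seg e a b => exact h₁
    | aux x =>
      refine Homotopic.trans h₁ ?_
      have hp := (hT.eta_INP x).path.1
      obtain ⟨rfl, h₂⟩ := h
      have := Homotopic.context (p := .vert (T.foot x.i)) (q := q) (u := []) (v := T.rhat w)
        (Homotopic.of_rel (R := fun l l' => GraphMove l l' ∨ ∃ x, l = [.aux x] ∧ l' = T.eta x)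
          (.inr ⟨x, rfl, rfl⟩) (p := .vert (T.foot x.i)) (q := .vert (T.foot x.t))
          ⟨rfl, rfl⟩ hp) rfl (hT.isPath_rhat h₂)
      simpa [rhat, rhatLetter, Letter.start] using this

theorem homG2_r {p q : T.toSkeleton.Pt} {w : T.Word} (h : IsPath p w q) :
    T.HomG2 p q w (T.r w) := by
  unfold r
  generalize T.depth = n
  induction n generalizing w with
  | zero => exact .refl h
  | succ n ih => exact (hT.homG2_rhat h).trans (ih (hT.isPath_rhat h))

theorem rhat_invW (w : T.Word) : T.rhat (invW w) = invW (T.rhat w) := by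
  induction w with
  | nil => rfl
  | cons x w ih =>
    rw [← List.singleton_append, invW_append, rhat_append, rhat_append, invW_append, ih]
    congr 1
    cases x with
    | seg e a b => rfl
    | aux x => simpa [rhat, rhatLetter, invW, Letter.inv] using hT.eta_inv x

theorem r_inv (x : T.toSkeleton.Aux) : T.r [.aux x.inv] = invW (T.r [.aux x]) := by
  unfold r
  generalize T.depth = n
  induction n with
  | zero => rfl
  | succ n ih => simp only [Function.iterate_succ_apply', ih, hT.rhat_invW]

/-- The left side amounts to one replacement more than the right side, and that extra replacement
does nothing because `r` already lands in `Γ`. -/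
theorem r_eta (x : T.toSkeleton.Aux) : T.r (T.eta x) = T.r [.aux x] := by
  have : T.eta x = T.rhat [.aux x] := by simp [rhat, rhatLetter]
  rw [this, r, ← Function.iterate_succ_apply, Function.iterate_succ_apply']
  exact rhat_of_inΓ (hT.r_inΓ x)

/-- The holonomy of the retraction of a path only depends on the homotopy class in the
2-complex. -/
theorem holonomy_r_eq {p q : T.toSkeleton.Pt} {w w' : T.Word} (h : T.HomG2 p q w w') :
    holonomy (T.r w) = holonomy (T.r w') := by
  refine Homotopic.invariant (F := fun w => holonomy (T.r w)) h ?_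
  intro u v l l' hl
  suffices holonomy (T.r l) = holonomy (T.r l') by
    simp only [r_append, holonomy_append, this]
  rcases hl with hl | ⟨x, rfl, rfl⟩
  · cases hl with
    -- Only this move is not formal: it rests on the compatibility of `r` with the stars, `r_star`.
    | star x y z hxy hi ht =>
      exact (hT.r_star x y z hxy hi ht).invariant fun u v l l' hl => by
        simp only [holonomy_append, hl.1.holonomy_eq]
    | cancel x =>
      rw [r_cons, hT.r_inv, holonomy_append, holonomy_invW, r_nil, holonomy_nil, mul_inv_cancel]
    | merge e a b c =>
      rw [r_of_inΓ (by simp [Letter.InΓ]), r_seg]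
      exact (GraphMove.merge e a b c).holonomy_eq
    | const e a =>
      rw [r_seg, r_nil]
      exact (GraphMove.const e a).holonomy_eq
  · rw [hT.r_eta]

theorem length_r_aux_pos (x : T.toSkeleton.Aux) : 0 < (T.r [.aux x]).length :=
  List.length_pos_iff.2 (hT.r_ne_nil (by simp))

/-- The word has trivial holonomy, so if reduced it would be empty. -/
theorem not_reduced_r_append_inv (x : T.toSkeleton.Aux) :
    ¬ Reduced (T.r [.aux x] ++ T.r [.aux x.inv]) := by
  intro h
  have hn : Nonconst (T.r [.aux x] ++ T.r [.aux x.inv]) := nonconst_of_full fun y hy =>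
    (List.mem_append.1 hy).elim ((hT.isEdgePath_r_aux x).2 y)
      ((hT.isEdgePath_r_aux x.inv).2 y)
  have := eq_of_holonomy_eq h hn (w' := []) List.isChain_nil (by simp [Nonconst])
    (by rw [hT.r_inv, holonomy_append, holonomy_invW, mul_inv_cancel, holonomy_nil])
  exact hT.r_ne_nil (by simp) (List.append_eq_nil_iff.1 this).1

/-- If two consecutive auxiliary edges have a half-edge in common and the concatenation of their
pre-INPs is reduced, then this concatenation is again a pre-INP. -/
theorem exists_r_eq_append {x y : T.toSkeleton.Aux} (hxy : x.t = y.i)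
    (h : Reduced (T.r [.aux x] ++ T.r [.aux y])) :
    ∃ z : T.toSkeleton.Aux, T.r [.aux z] = T.r [.aux x] ++ T.r [.aux y] := by
  -- Either `y` is `x` reversed, or the two outer half-edges form a third auxiliary edge of the
  -- star.
  by_cases hne : x.i = y.t
  · obtain rfl : y = x.inv := Skeleton.Aux.ext hxy.symm hne.symm
    exact (hT.not_reduced_r_append_inv x h).elim
  · let z : T.toSkeleton.Aux := ⟨x.i, y.t, hne, by rw [x.ctr_eq, hxy, y.ctr_eq]⟩
    refine ⟨z, ?_⟩
    have hh : holonomy (T.r [.aux x, .aux y]) = holonomy (T.r [.aux z]) :=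
      (hT.r_star x y z hxy rfl rfl).invariant fun u v l l' hl => by
        simp only [holonomy_append, hl.1.holonomy_eq]
    rw [r_cons] at hh
    refine eq_of_holonomy_eq (hT.r_reduced z) (nonconst_of_full (hT.isEdgePath_r_aux z).2) h
      (nonconst_of_full fun u hu => ?_) hh.symm
    exact (List.mem_append.1 hu).elim ((hT.isEdgePath_r_aux x).2 u)
      ((hT.isEdgePath_r_aux y).2 u)

end IsPartialTrainTrack

/-- Different auxiliary edges have different pre-INPs. -/
theorem IsBetaTrainTrack.r_aux_injective (hT : T.IsBetaTrainTrack) {x y : T.toSkeleton.Aux}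
    (h : T.r [.aux x] = T.r [.aux y]) : x = y := by
  have hP := hT.toIsPartialTrainTrack
  have hx := hP.isEdgePath_r_aux x
  have hy := hP.isEdgePath_r_aux y
  rw [← h] at hy
  obtain ⟨hi, ht⟩ := hx.1.eq_of_ne_nil hy.1 (hP.r_ne_nil (by simp))
  have path : ∀ z : T.toSkeleton.Aux,
      IsPath (.vert (T.foot z.i)) [Letter.aux z, .aux y.inv] (.vert (T.foot y.i)) ↔
        (.vert (T.foot y.t) : T.toSkeleton.Pt) = .vert (T.foot z.t) := by
    intro z; simp [IsPath, Letter.start, Letter.finish, Aux.inv]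
  have hxy : IsPath (.vert (T.foot y.i)) [Letter.aux x, .aux y.inv] (.vert (T.foot y.i)) := by
    rw [← hi]; exact hi ▸ (path x).2 ht.symm
  have hyy := (path y).2 rfl
  have hr : T.r [.aux x, .aux y.inv] = T.r [.aux y, .aux y.inv] := by
    rw [r_cons, h, ← r_cons]
  -- The loop `x` followed by `y` reversed has the same retraction as `y` followed by `y` reversed,
  -- so it is null-homotopic in the 2-complex. Being contained in `X`, it is then null-homotopic in
  -- `X`.
  have hnull : T.HomG2 (.vert (T.foot y.i)) (.vert (T.foot y.i)) [.aux x, .aux y.inv] [] := by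
    refine (hP.homG2_r hxy).trans ?_
    rw [hr]
    refine (hP.homG2_r hyy).symm.trans (HomG2.of_homG1 ?_)
    exact Homotopic.of_rel (.cancel y) hyy rfl
  have hX := hT.X_injective (T.foot y.i) _ ⟨hxy, by simp [Letter.Full]⟩ (by simp [Letter.InX])
    hnull
  have hol : holonomy [(.aux x : T.toSkeleton.Letter), .aux y.inv] =
      holonomy ([] : T.Word) :=
    hX.invariant fun u v l l' hl => by simp only [holonomy_append, hl.1.holonomy_eq]
  have hol' : holonomy [(.aux x : T.toSkeleton.Letter)] = holonomy [(.aux y)] := by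
    have h₁ : holonomy [(.aux y.inv : T.toSkeleton.Letter)] = (holonomy [.aux y])⁻¹ :=
      holonomy_invW [.aux y]
    rw [← List.singleton_append, holonomy_append, h₁, holonomy_nil, mul_inv_eq_one] at hol
    exact hol
  have := eq_of_holonomy_eq (List.isChain_singleton _) (by simp [Nonconst])
    (List.isChain_singleton _) (by simp [Nonconst]) hol'
  simpa using this

/-! ### Replacing disjoint pre-INPs by auxiliary edges -/

/-- The word `w` runs through the auxiliary edge `x` such that its retraction starts after `n`
letters of the retraction of `w`. -/
def AuxAt (w : T.Word) (n : ℕ) (x : T.toSkeleton.Aux) : Prop :=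
  ∃ w₁ w₂ : T.Word, w = w₁ ++ [.aux x] ++ w₂ ∧ (T.r w₁).length = n

theorem not_auxAt_nil (n : ℕ) (x : T.toSkeleton.Aux) : ¬ AuxAt (T := T) [] n x := by
  rintro ⟨w₁, w₂, h, -⟩
  simp at h

theorem auxAt_cons {y : T.toSkeleton.Letter} {w : T.Word} {n : ℕ} {x : T.toSkeleton.Aux} :
    AuxAt (y :: w) n x ↔ (n = 0 ∧ y = .aux x) ∨ ∃ m, n = (T.r [y]).length + m ∧ AuxAt w m x := by
  constructor
  · rintro ⟨w₁, w₂, h, rfl⟩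
    cases w₁ with
    | nil =>
      simp at h
      exact .inl ⟨by simp [r_nil], h.1⟩
    | cons z w₁ =>
      simp only [List.cons_append, List.cons.injEq] at h
      obtain ⟨rfl, rfl⟩ := h
      exact .inr ⟨(T.r w₁).length, by rw [r_cons, List.length_append], w₁, w₂, rfl, rfl⟩
  · rintro (⟨rfl, rfl⟩ | ⟨m, rfl, w₁, w₂, rfl, rfl⟩)
    · exact ⟨[], w, rfl, by simp [r_nil]⟩
    · exact ⟨y :: w₁, w₂, rfl, by rw [r_cons, List.length_append]⟩

/-- A word is determined by its retraction and the positions of its auxiliary edges. -/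
theorem IsPartialTrainTrack.eq_of_auxAt_iff (hT : T.IsPartialTrainTrack) {w w' : T.Word}
    (hr : T.r w = T.r w') (h : ∀ n x, AuxAt w n x ↔ AuxAt w' n x) : w = w' := by
  induction w generalizing w' with
  | nil =>
    by_contra hne
    exact hT.r_ne_nil (Ne.symm hne) (hr ▸ r_nil)
  | cons y w ih =>
    cases w' with
    | nil => exact (hT.r_ne_nil (by simp) (hr.trans r_nil)).elim
    | cons y' w' =>
      have pos : ∀ z : T.toSkeleton.Letter, 0 < (T.r [z]).length := fun z =>
        List.length_pos_iff.2 (hT.r_ne_nil (by simp))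
      -- Position 0 reveals the first letter: pieces are nonempty, so no later auxiliary edge can
      -- start there.
      have zero : ∀ (z : T.toSkeleton.Letter) (v : T.Word) (x : T.toSkeleton.Aux),
          AuxAt (z :: v) 0 x ↔ z = .aux x := by
        intro z v x
        rw [auxAt_cons]
        have := pos z
        constructor
        · rintro (⟨-, h⟩ | ⟨m, hm, -⟩)
          · exact h
          · omega
        · exact fun h => .inl ⟨rfl, h⟩
      obtain rfl : y = y' := by
        cases y with
        | aux x => exact (((zero _ _ _).1 ((h 0 x).1 ((zero _ _ _).2 rfl)))).symm
        | seg e a b =>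
          cases y' with
          | aux x => exact ((zero _ _ _).1 ((h 0 x).2 ((zero _ _ _).2 rfl)))
          | seg e' a' b' =>
            rw [r_cons, r_cons (.seg e' a' b'), r_seg, r_seg] at hr
            exact (List.cons.inj hr).1
      congr 1
      rw [r_cons, r_cons y w'] at hr
      refine ih (List.append_cancel_left hr) fun n x => ?_
      have shift : ∀ v : T.Word, AuxAt (y :: v) ((T.r [y]).length + n) x ↔ AuxAt v n x := by
        intro v
        rw [auxAt_cons]
        have := pos y
        constructor
        · rintro (⟨hn, -⟩ | ⟨m, hm, hv⟩)
          · omega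
          · obtain rfl : n = m := by omega
            exact hv
        · exact fun hv => .inr ⟨n, rfl, hv⟩
      rw [← shift, ← shift, h]

/-- Pairwise disjoint pre-INPs of a path in `Γ` can be replaced by auxiliary edges. -/
theorem IsPartialTrainTrack.exists_auxAt_iff (hT : T.IsPartialTrainTrack) (ρ : T.Word)
    (hΓ : ∀ x ∈ ρ, x.InΓ) (S : ℕ → T.toSkeleton.Aux → Prop)
    (hS : ∀ n x, S n x → T.OccursAt ρ n x)
    (hdisj : ∀ n x m y, S n x → S m y → (n = m ∧ x = y) ∨
      n + (T.r [.aux x]).length ≤ m ∨ m + (T.r [.aux y]).length ≤ n) :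
    ∃ w : T.Word, T.r w = ρ ∧ ∀ n x, AuxAt w n x ↔ S n x := by
  induction hl : ρ.length using Nat.strong_induction_on generalizing ρ S with
  | _ l ih =>
    /- split off one letter `a` of the desired word -/
    have step : ∀ (a : T.toSkeleton.Letter) (ρ' : T.Word), ρ = T.r [a] ++ ρ' →
        (∀ n x, S n x → (n = 0 ∧ a = .aux x) ∨ (T.r [a]).length ≤ n) →
        (∀ x, a = .aux x → S 0 x) →
        ∃ w : T.Word, T.r w = ρ ∧ ∀ n x, AuxAt w n x ↔ S n x := by
      rintro a ρ' rfl h₁ h₂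
      have pos : 0 < (T.r [a]).length := List.length_pos_iff.2 (hT.r_ne_nil (by simp))
      obtain ⟨w, hw, hw'⟩ := ih ρ'.length (by rw [← hl, List.length_append]; omega) ρ'
        (fun x hx => hΓ x (List.mem_append_right _ hx))
        (fun n x => S ((T.r [a]).length + n) x)
        (by
          intro n x hn
          obtain ⟨u, v, huv, hu⟩ := hS _ _ hn
          -- The occurrence starts after the piece `r [a]`, so it survives in `ρ'` with its position
          -- shifted.
          have hpre : T.r [a] <+: u := by
            refine List.prefix_of_prefix_length_le (List.prefix_append _ ρ') ?_ (by omega)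
            rw [huv, List.append_assoc]
            exact List.prefix_append _ _
          obtain ⟨u', rfl⟩ := hpre
          refine ⟨u', v, ?_, by rw [List.length_append] at hu; omega⟩
          simpa [List.append_assoc] using huv)
        (by
          intro n x m y hn hm
          rcases hdisj _ _ _ _ hn hm with h | h | h
          · exact .inl ⟨by omega, h.2⟩
          · exact .inr (.inl (by omega))
          · exact .inr (.inr (by omega)))
        rfl
      refine ⟨a :: w, by rw [r_cons, hw], fun n x => ?_⟩
      rw [auxAt_cons]
      constructor
      · rintro (⟨rfl, ha⟩ | ⟨m, rfl, hm⟩)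
        · exact h₂ x ha
        · exact (hw' m x).1 hm
      · intro hn
        rcases h₁ n x hn with h | h
        · exact .inl h
        · obtain ⟨m, rfl⟩ := Nat.exists_eq_add_of_le h
          exact .inr ⟨m, rfl, (hw' m x).2 hn⟩
    -- The first letter is the auxiliary edge selected at position 0, if there is one, and otherwise
    -- the first letter of `ρ`.
    by_cases h0 : ∃ x, S 0 x
    · obtain ⟨x, hx⟩ := h0
      obtain ⟨u, v, huv, hu⟩ := hS 0 x hx
      obtain rfl := List.length_eq_zero_iff.1 hu
      refine step (.aux x) v (by simpa using huv) ?_ ?_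
      · intro n y hy
        rcases hdisj _ _ _ _ hx hy with ⟨rfl, rfl⟩ | h | h
        · exact .inl ⟨rfl, rfl⟩
        · exact .inr (by omega)
        · have := hT.length_r_aux_pos y
          omega
      · rintro y hy
        cases hy
        exact hx
    · push Not at h0
      cases ρ with
      | nil =>
        refine ⟨[], r_nil, fun n x => ⟨fun h => (not_auxAt_nil n x h).elim, fun h => ?_⟩⟩
        obtain ⟨u, v, huv, -⟩ := hS n x h
        rw [List.append_assoc, eq_comm, List.append_eq_nil_iff, List.append_eq_nil_iff] at huv
        exact (hT.r_ne_nil (by simp) huv.2.1).elim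
      | cons a ρ' =>
        cases a with
        | aux x => exact (hΓ (.aux x) (by simp)).elim
        | seg e a b =>
          refine step (.seg e a b) ρ' (by rw [r_seg]; rfl) ?_ (by simp)
          intro n x hn
          have : n ≠ 0 := by rintro rfl; exact h0 x hn
          exact .inr (by rw [r_seg]; simp only [List.length_singleton]; omega)

/-- If the two overlap, isolation of each forces containment both ways, hence the same place and the
same word; `r_aux_injective` concludes. -/
theorem IsBetaTrainTrack.isolatedAt_disjoint (hT : T.IsBetaTrainTrack) {ρ : T.Word} {n m : ℕ}
    {x y : T.toSkeleton.Aux} (hx : T.IsolatedAt ρ n x) (hy : T.IsolatedAt ρ m y) :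
    (n = m ∧ x = y) ∨
      n + (T.r [.aux x]).length ≤ m ∨ m + (T.r [.aux y]).length ≤ n := by
  have hlx := hT.length_r_aux_pos x
  have hly := hT.length_r_aux_pos y
  by_contra! hcon
  obtain ⟨h₁, h₂, h₃⟩ := hcon
  have hxy := hx.2 m y hy.1 (by omega)
  have hyx := hy.2 n x hx.1 (by omega)
  obtain rfl : n = m := by omega
  have hlen : (T.r [.aux x]).length = (T.r [.aux y]).length := by omega
  obtain ⟨u, v, h, hu⟩ := hx.1
  obtain ⟨u', v', h', hu'⟩ := hy.1
  rw [h, List.append_assoc, List.append_assoc] at h'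
  obtain ⟨-, h'⟩ := List.append_inj h' (hu.trans hu'.symm)
  exact h₁ rfl (hT.r_aux_injective (List.append_inj h' hlen).1)

/-- A nonempty word determines its endpoints, and `r [.aux x]` joins the feet of `x`; so the
auxiliary edge fits wherever its pre-INP does. -/
theorem IsPartialTrainTrack.isGPath_of_r (hT : T.IsPartialTrainTrack) {p q : T.toSkeleton.Pt}
    {w : T.Word} (h : IsGPath p (T.r w) q) : IsGPath p w q := by
  obtain ⟨hp, hs, hc⟩ := h
  refine ⟨?_, ?_, ?_⟩
  · clear hs hc
    induction w generalizing p with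
    | nil => rwa [r_nil] at hp
    | cons x w ih =>
      rw [r_cons] at hp
      cases x with
      | seg e a b =>
        rw [r_seg] at hp
        exact ⟨hp.1, ih hp.2⟩
      | aux x =>
        obtain ⟨m, h₁, h₂⟩ := isPath_append.1 hp
        obtain ⟨rfl, rfl⟩ := h₁.eq_of_ne_nil (hT.isEdgePath_r_aux x).1 (hT.r_ne_nil (by simp))
        exact ⟨rfl, ih h₂⟩
  · intro e a b hm
    apply hs
    obtain ⟨u, v, rfl⟩ := List.append_of_mem hm
    rw [r_append, r_cons, r_seg]
    simp
  · clear hp hs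
    induction w with
    | nil => exact List.isChain_nil
    | cons x w ih =>
      rw [r_cons] at hc
      obtain ⟨-, hc₂, hc₃⟩ := List.isChain_append.1 hc
      refine List.isChain_cons.2 ⟨?_, ih hc₂⟩
      intro y hy
      cases x with
      | aux x => exact ⟨_, rfl⟩
      | seg e a b =>
        rw [r_seg] at hc₃
        have hw : T.r w ≠ [] := hT.r_ne_nil (by rintro rfl; simp at hy)
        exact hc₃ _ rfl _ (List.head?_eq_some_head hw)

/-- Replacing the isolated pre-INPs of a reduced path in `Γ` does not create backtracking in the
relative part. -/
theorem IsPartialTrainTrack.xReduced_of_normalized (hT : T.IsPartialTrainTrack) {w : T.Word}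
    (h : T.Normalized w) : XReduced w := by
  obtain ⟨hred, -, hiso⟩ := h
  refine List.isChain_iff_forall_rel_of_append_cons_cons.2 ?_
  intro a b l₁ l₂ hw _ _ hb
  have hr : T.r w = T.r l₁ ++ (T.r [a] ++ T.r [b]) ++ T.r l₂ := by
    rw [hw, r_append, r_cons, r_cons b]
    simp only [List.append_assoc]
  have hab : Reduced (T.r [a] ++ T.r [b]) :=
    hred.infix ⟨T.r l₁, T.r l₂, hr.symm⟩
  cases a with
  | seg e s t =>
    cases b with
    | seg e' s' t' =>
      rw [r_seg, r_seg] at hab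
      exact (List.isChain_cons_cons.1 hab).1 hb
    | aux y => exact hb
  | aux x =>
    cases b with
    | seg e s t => exact hb
    | aux y =>
      obtain ⟨z, hz⟩ := hT.exists_r_eq_append hb hab
      have hx := (hiso (T.r l₁).length x).1 ⟨l₁, .aux y :: l₂, by simp [hw], rfl⟩
      have hlx := hT.length_r_aux_pos x
      have hly := hT.length_r_aux_pos y
      have hlz : (T.r [.aux z]).length = (T.r [.aux x]).length + (T.r [.aux y]).length := by
        rw [hz, List.length_append]
      -- The pre-INP of `z` starts together with that of `x` and is strictly longer, which isolation
      -- forbids.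
      have := hx.2 (T.r l₁).length z ⟨T.r l₁, T.r l₂, by rw [hr, hz], rfl⟩ (by omega)
      omega

end TrackMap

end BetaTT

/-! ### Existence and uniqueness of the normalized path -/

theorem proposition6 {V E H C : Type*}
    (T : BetaTT.TrackMap V E H C) (hT : T.IsBetaTrainTrack)
    (p q : T.toSkeleton.Pt) (γ : T.Word) (hγ : BetaTT.Skeleton.IsGPath p γ q) :
    ∃! γ' : T.Word, (BetaTT.Skeleton.IsGPath p γ' q ∧ BetaTT.Skeleton.XReduced γ') ∧
      T.Normalized γ' ∧ T.HomG2 p q γ γ' := by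
  have hP := hT.toIsPartialTrainTrack
  obtain ⟨ρ, hρ, hΓ, hhom, hred⟩ := (hP.isGPath_r hγ).exists_reduced (hP.inΓ_r γ)
  obtain ⟨w, rfl, hiso⟩ := hP.exists_auxAt_iff ρ hΓ (T.IsolatedAt ρ) (fun n x h => h.1)
    (fun n x m y hx hy => hT.isolatedAt_disjoint hx hy)
  have hw : BetaTT.Skeleton.IsGPath p w q := hP.isGPath_of_r hρ
  have hN : T.Normalized w := ⟨hred, rfl, hiso⟩
  have hγw : T.HomG2 p q γ w :=
    (hP.homG2_r hγ.1).trans ((BetaTT.TrackMap.HomG2.of_homG1 hhom).trans (hP.homG2_r hw.1).symm)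
  refine ⟨w, ⟨⟨hw, hP.xReduced_of_normalized hN⟩, hN, hγw⟩, ?_⟩
  rintro w' ⟨⟨hw', -⟩, hN', hγw'⟩
  -- Both retractions are reduced and have the same holonomy, since `w` and `w'` are both homotopic
  -- to `γ`.
  have hr : T.r w' = T.r w :=
    BetaTT.Skeleton.eq_of_holonomy_eq hN'.1 (hP.isGPath_r hw').nonconst hred hρ.nonconst
      (hP.holonomy_r_eq (hγw'.symm.trans hγw))
  refine hP.eq_of_auxAt_iff hr fun n x => ?_
  exact (hN'.2.2 n x).trans (hr ▸ (hiso n x).symm)
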